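/- Let $n\ge 1$, $m\ge 0$, let $f,c_1,\dots,c_m:\mathbb R^n\to\mathbb R$ be twice continuously differentiable, and let $\Omega=\{x\in\mathbb R^n: c_i(x)=0,\ i=1,\dots,m\}$. Write $\nabla c(x)=[\nabla c_1(x),\dots,\nabla c_m(x)]\in\mathbb R^{n\times m}$, let $\mathcal P_x$ be the orthogonal projection onto $\{\nabla c_1(x),\dots,\nabla c_m(x)\}^\perp$, let $\mathcal L(x,\mu)=f(x)-\sum_i\mu_ic_i(x)$, and for $x\in\Omega$ put $$\lambda^\star(x)\in\arg\min_{\mu\in\mathbb R^m}\|\nabla_x\mathcal L(x,\mu)\|,\qquad \mathcal G(x)=\nabla_x\mathcal L(x,\lambda^\star(x)),\qquad \mathcal H(x)=\mathcal P_x^\top\nabla^2_{xx}\mathcal L(x,\lambda^\star(x))\mathcal P_x .$$ For $y\in\mathbb R^n$ let $\Pi_\Omega(y)$ be a point of $\Omega$ closest to $y$ in the Euclidean norm. Assume: (a) $\nabla f,\nabla^2f,\nabla c_i,\nabla^2c_i$ are Lipschitz over $\Omega$, also along the segments joining points of $\Omega$: each of these maps $g$ has a constant $L$ with $\|g(z)-g(x)\|\le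 L\|z-x\|$ for all $x,y\in\Omega$ and all $z$ on the segment $[x,y]$. (b) $\nabla f,\nabla^2f,\nabla c_i,\nabla^2c_i$ are bounded on $\Omega$. (c) There is $\sigma_0>0$ such that for every $x\in\Omega$ all $m$ singular values of $\nabla c(x)$ (the square roots of the eigenvalues of $\nabla c(x)^\top\nabla c(x)$) are at least $\sigma_0$. (d) $f$ is bounded below on $\Omega$. Let $0<\sigma<1$, $0<\rho<1$, $\alpha>0$, $\epsilon>0$, $t_0>0$, and consider the following algorithm, started at any $x_0\in\Omega$. At iteration $k$ let $\mathcal G_k=\mathcal G(x_k)$, $\mathcal H_k=\mathcal H(x_k)$, $\lambda_k=\min\{\lambda_{\min}(\mathcal H_k),0\}$. * If $\|\mathcal G_k\|\ge\epsilon$, let $\hat x(t)=\Pi_\Omega(x_k-t\mathcal G_k)$ and let $t_k$ be the first $t$ in the sequence $t_0,\rho t_0,\rho^2t_0,\dots$ with $f(\hat x(t))-f(x_k)\le-\sigma t\|\mathcal G_k\|^2$. * If $\|\mathcal G_k\|<\epsilon$, let $v_k$ be a unit eigenvector of $\mathcal H_k$ for its algebraically smallest eigenvalue, $d_k=|\lambda_k|\,\mathrm{sign}(-v_k^\top\mathcal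 G_k)\,v_k$ (with $\mathrm{sign}(0)$ either of $\pm1$), $\hat x(t)=\Pi_\Omega(x_k-t\mathcal G_k+t^\alpha d_k)$, and let $t_k$ be the first $t$ in the sequence $t_0,\rho t_0,\rho^2t_0,\dots$ with $f(\hat x(t))-f(x_k)\le\sigma\bigl(-t\|\mathcal G_k\|^2-\tfrac12t^{2\alpha}|\lambda_k|^3\bigr)$. In both cases set $x_{k+1}=\hat x(t_k)$. Then the algorithm is well defined: at every point of $\Omega$ each step can be carried out and each line search terminates, for every choice of $v_k$ and of the sign. For every sequence $(x_k)$ that it generates, $\mathcal G_k\to0$ and $\lambda_k\to0$ as $k\to\infty$. Hence every cluster point $x^\star$ of $(x_k)$ is a second-order critical point: $x^\star\in\Omega$, $\mathcal G(x^\star)=0$ and $\mathcal H(x^\star)\succeq0$. -/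

import Mathlib

open Filter Topology Set
open scoped InnerProductSpace

noncomputable section

namespace NegCurv

/-- `ℝⁿ` with the Euclidean norm. -/
abbrev E (n : ℕ) : Type := EuclideanSpace ℝ (Fin n)

variable {n m : ℕ}

/-- The feasible set `Ω = {x | c_i(x) = 0 for all i}`. -/
def feasible (c : Fin m → E n → ℝ) : Set (E n) := {x | ∀ i, c i x = 0}

/-- The Hessian `∇²g(x)`, as a linear operator: the derivative of the gradient field of `g`. -/
def hess (g : E n → ℝ) (x : E n) : E n →L[ℝ] E n := fderiv ℝ (gradient g) x

/-- The matrix `∇c(x) = [∇c_1(x), …, ∇c_m(x)] ∈ ℝ^{n × m}`. -/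
def jac (c : Fin m → E n → ℝ) (x : E n) : Matrix (Fin n) (Fin m) ℝ :=
  Matrix.of fun j i => gradient (c i) x j

/-- Every one of the `m` singular values of `∇c(x)` is at least `s`, i.e. `σ_min(∇c(x)) ≥ s`. -/
def SigmaMinGE (c : Fin m → E n → ℝ) (x : E n) (s : ℝ) : Prop :=
  ∀ i : Fin m, s ≤ (Matrix.toEuclideanLin (jac c x)).singularValues i

/-- The normal subspace at `x`, spanned by the constraint gradients. -/
def normalSpace (c : Fin m → E n → ℝ) (x : E n) : Submodule ℝ (E n) :=
  Submodule.span ℝ (Set.range fun i => gradient (c i) x)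

/-- The tangent subspace at `x`, the orthogonal complement of the normal subspace. -/
def tangentSpace (c : Fin m → E n → ℝ) (x : E n) : Submodule ℝ (E n) := (normalSpace c x)ᗮ

/-- The orthogonal projection `𝒫_x` onto the tangent subspace, as an operator on `ℝⁿ`. -/
def tanProj (c : Fin m → E n → ℝ) (x : E n) : E n →L[ℝ] E n :=
  (tangentSpace c x).starProjection

/-- The Lagrangian `ℒ(x, μ) = f(x) - ∑ μ_i c_i(x)`. -/
def lagrangian (f : E n → ℝ) (c : Fin m → E n → ℝ) (x : E n) (μ : Fin m → ℝ) : ℝ :=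
  f x - ∑ i, μ i * c i x

/-- `∇_x ℒ(x, μ)`. -/
def gradL (f : E n → ℝ) (c : Fin m → E n → ℝ) (x : E n) (μ : Fin m → ℝ) : E n :=
  gradient (fun y => lagrangian f c y μ) x

/-- `∇²_{xx} ℒ(x, μ)`. -/
def hessL (f : E n → ℝ) (c : Fin m → E n → ℝ) (x : E n) (μ : Fin m → ℝ) : E n →L[ℝ] E n :=
  hess (fun y => lagrangian f c y μ) x

/-- `lam x ∈ argmin_μ ‖∇_x ℒ(x, μ)‖` for every feasible `x`. -/
def IsMultiplier (f : E n → ℝ) (c : Fin m → E n → ℝ) (lam : E n → Fin m → ℝ) : Prop :=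
  ∀ x ∈ feasible c, ∀ μ : Fin m → ℝ, ‖gradL f c x (lam x)‖ ≤ ‖gradL f c x μ‖

/-- The generalized gradient `𝒢(x) = ∇_x ℒ(x, λ⋆(x))`. -/
def genGrad (f : E n → ℝ) (c : Fin m → E n → ℝ) (lam : E n → Fin m → ℝ) (x : E n) : E n :=
  gradL f c x (lam x)

/-- The generalized Hessian `ℋ(x) = 𝒫_xᵀ ∇²_{xx} ℒ(x, λ⋆(x)) 𝒫_x`. -/
def genHess (f : E n → ℝ) (c : Fin m → E n → ℝ) (lam : E n → Fin m → ℝ) (x : E n) :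
    E n →L[ℝ] E n :=
  (ContinuousLinearMap.adjoint (tanProj c x)) ∘L (hessL f c x (lam x)) ∘L (tanProj c x)

/-- The algebraically smallest eigenvalue of an operator on `ℝⁿ` (used for symmetric operators,
`n ≥ 1`, whose set of real eigenvalues is finite and nonempty). -/
def minEig (T : E n →L[ℝ] E n) : ℝ :=
  sInf {μ : ℝ | Module.End.HasEigenvalue (T : E n →ₗ[ℝ] E n) μ}

/-- `min {λ_min(ℋ(x)), 0}`. -/
def negEig (f : E n → ℝ) (c : Fin m → E n → ℝ) (lam : E n → Fin m → ℝ) (x : E n) : ℝ :=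
  min (minEig (genHess f c lam x)) 0

/-- `Pi y` is, for every `y`, a point of `Ω` closest to `y`. -/
def IsProj (Ω : Set (E n)) (Pi : E n → E n) : Prop :=
  ∀ y, Pi y ∈ Ω ∧ ∀ x ∈ Ω, ‖Pi y - y‖ ≤ ‖x - y‖

/-- `g` is Lipschitz over `Ω`, also along the segments that join two points of `Ω`
(`z = y` gives the Lipschitz inequality between points of `Ω`). -/
def LipOver {F : Type*} [NormedAddCommGroup F] (Ω : Set (E n)) (g : E n → F) : Prop :=
  ∃ L : ℝ, ∀ x ∈ Ω, ∀ y ∈ Ω, ∀ z ∈ segment ℝ x y, ‖g z - g x‖ ≤ L * ‖z - x‖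

/-- `g` is bounded over `Ω`. -/
def BddOver {F : Type*} [NormedAddCommGroup F] (Ω : Set (E n)) (g : E n → F) : Prop :=
  ∃ γ : ℝ, ∀ x ∈ Ω, ‖g x‖ ≤ γ

/-- The standing assumptions: smoothness, Lipschitz and bounded first and second derivatives over
the feasible set, and the constraint qualification with a uniform constant `σ₀ > 0`. -/
structure KeyAssumption (f : E n → ℝ) (c : Fin m → E n → ℝ) : Prop where
  smooth_f : ContDiff ℝ 2 f
  smooth_c : ∀ i, ContDiff ℝ 2 (c i)
  lip_grad_f : LipOver (feasible c) (gradient f)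
  lip_hess_f : LipOver (feasible c) (hess f)
  lip_grad_c : ∀ i, LipOver (feasible c) (gradient (c i))
  lip_hess_c : ∀ i, LipOver (feasible c) (hess (c i))
  bdd_grad_f : BddOver (feasible c) (gradient f)
  bdd_hess_f : BddOver (feasible c) (hess f)
  bdd_grad_c : ∀ i, BddOver (feasible c) (gradient (c i))
  bdd_hess_c : ∀ i, BddOver (feasible c) (hess (c i))
  licq : ∃ σ₀ : ℝ, 0 < σ₀ ∧ ∀ x ∈ feasible c, SigmaMinGE c x σ₀

/-- The input parameters of the algorithm. -/
structure Params where
  σ : ℝ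
  ρ : ℝ
  α : ℝ
  ε : ℝ
  t₀ : ℝ
  σ_pos : 0 < σ
  σ_lt : σ < 1
  ρ_pos : 0 < ρ
  ρ_lt : ρ < 1
  α_pos : 0 < α
  ε_pos : 0 < ε
  t₀_pos : 0 < t₀

/-- The backtracking loop that starts from `t₀` and multiplies `t` by `ρ` until `test t` holds
terminates with the value `t`. -/
def Backtrack (p : Params) (test : ℝ → Prop) (t : ℝ) : Prop :=
  ∃ j : ℕ, t = p.t₀ * p.ρ ^ j ∧ test t ∧ ∀ i < j, ¬ test (p.t₀ * p.ρ ^ i)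

section Algorithm

variable (p : Params) (f : E n → ℝ) (c : Fin m → E n → ℝ) (lam : E n → Fin m → ℝ)
  (Pi : E n → E n)

/-- The trial point of a gradient step. -/
def gradTrial (x : E n) (t : ℝ) : E n := Pi (x - t • genGrad f c lam x)

/-- The exit test of the line search of a gradient step. -/
def gradTest (x : E n) (t : ℝ) : Prop :=
  f (gradTrial f c lam Pi x t) - f x ≤ -p.σ * t * ‖genGrad f c lam x‖ ^ 2

/-- `d = |λ| sign(-vᵀ𝒢) v`, where `v` is a unit eigenvector for the smallest eigenvalue of `ℋ(x)`
and `λ = min {λ_min(ℋ(x)), 0}`; the sign `s` is `1` or `-1`, either one if `vᵀ𝒢 = 0`. -/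
def IsDirection (x d : E n) : Prop :=
  ∃ (v : E n) (s : ℝ), ‖v‖ = 1 ∧
    genHess f c lam x v = minEig (genHess f c lam x) • v ∧
    (s = 1 ∨ s = -1) ∧ 0 ≤ s * (-⟪v, genGrad f c lam x⟫_ℝ) ∧
    d = (|negEig f c lam x| * s) • v

/-- The trial point of a curvilinear step. -/
def curvTrial (x d : E n) (t : ℝ) : E n := Pi (x - t • genGrad f c lam x + t ^ p.α • d)

/-- The exit test of the line search of a curvilinear step. -/
def curvTest (x d : E n) (t : ℝ) : Prop :=
  f (curvTrial p f c lam Pi x d t) - f x ≤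
    p.σ * (-t * ‖genGrad f c lam x‖ ^ 2
      - 1 / 2 * t ^ (2 * p.α) * |negEig f c lam x| ^ 3)

/-- `x'` is a possible outcome of one iteration of the algorithm at the iterate `x`. -/
def Iteration (x x' : E n) : Prop :=
  (p.ε ≤ ‖genGrad f c lam x‖ ∧
    ∃ t, Backtrack p (gradTest p f c lam Pi x) t ∧ x' = gradTrial f c lam Pi x t) ∨
  (‖genGrad f c lam x‖ < p.ε ∧
    ∃ d t, IsDirection f c lam x d ∧ Backtrack p (curvTest p f c lam Pi x d) t ∧
      x' = curvTrial p f c lam Pi x d t)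

/-- `x` is an infinite sequence of iterates generated by the algorithm. -/
def IsRun (x : ℕ → E n) : Prop :=
  x 0 ∈ feasible c ∧ ∀ k, Iteration p f c lam Pi (x k) (x (k + 1))

/-- At the feasible point `x` no instruction of the algorithm can fail: the line search of the
branch that is taken terminates, and in the curvilinear branch a direction exists and the line
search terminates for every admissible choice of it. -/
def IterationTerminates (x : E n) : Prop :=
  (p.ε ≤ ‖genGrad f c lam x‖ → ∃ t, Backtrack p (gradTest p f c lam Pi x) t) ∧
  (‖genGrad f c lam x‖ < p.ε →
    (∃ d, IsDirection f c lam x d) ∧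
    ∀ d, IsDirection f c lam x d → ∃ t, Backtrack p (curvTest p f c lam Pi x d) t)

end Algorithm

/-- Second-order critical points: feasible points with `𝒢(x) = 0` and `ℋ(x) ⪰ 0`. -/
def IsSecondOrderCritical (f : E n → ℝ) (c : Fin m → E n → ℝ) (lam : E n → Fin m → ℝ)
    (x : E n) : Prop :=
  x ∈ feasible c ∧ genGrad f c lam x = 0 ∧ (genHess f c lam x).IsPositive

end NegCurv

end

/-!
The proof rests on an expansion of `f` along projected tangent steps that is uniform over the
feasible set `Ω`. Let `x ∈ Ω`, let `s` be tangent at `x`, and put `z = Π(x + s)`,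
`r = z - (x + s)`. Since `x` itself competes for the closest point, `‖r‖ ≤ ‖s‖`; no smallness of
`s` is ever needed. By the multiplier rule (`exists_sub_proj_eq_sum`) `r` is a combination of the
constraint gradients at `z`, and the Taylor expansion of the constraints together with the lower
bound on the singular values gives `‖r‖ = O(‖s‖²)` (`norm_proj_sub_le_sq`). The normal spaces at `x`
and `z` differ by `O(‖s‖)`, so the component of `r` along the tangent vector `𝒢(x)` is `O(‖s‖³)`
(`inner_proj_sub_le`). As the constraints vanish at `x` and `z`, the function `f` may be replaced by
the Lagrangian with the multiplier of `x`, whose Taylor expansion yields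
`f z - f x ≤ ⟪𝒢(x), s⟫ + ½ ⟪ℋ(x) s, s⟫ + K ‖s‖³` (`exists_descent_bound`).

For `s = -t 𝒢 + τ d` with `d` as in the algorithm, all cross terms have the favourable sign, since
`ℋ d = λ d` with `λ ≤ 0` and `⟪𝒢, d⟫ ≤ 0`. What remains is
`-t ‖𝒢‖² (1 - O(t)) - ½ τ² |λ|³ (1 - O(τ))` (`exists_decrease_bound`), so that every step size below
some bound independent of `x` passes the tests (`exists_uniform_step`). Hence the line searches
terminate, the accepted step sizes are bounded away from zero, and each iteration decreases `f` by
a fixed multiple of `‖𝒢‖²`, and of `|λ|³` when `‖𝒢‖ < ε`. Since `f` is bounded below on `Ω`, the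
decreases tend to zero; so does `𝒢`, all late iterations are curvilinear, and `λ` tends to zero.

At cluster points the conclusion follows because the least-squares multiplier and the tangent
projection depend continuously on the feasible point (`tendsto_coeff`), hence so do `𝒢` and the
quadratic forms of `ℋ`.
-/

noncomputable section

namespace NegCurv

variable {n m : ℕ}

/-! ### Symmetric operators and singular values -/

/-- A symmetric operator whose eigenvalues are all at least `a` has Rayleigh quotients at
least `a`. -/
theorem mul_norm_sq_le_inner_of_le_eigenvalues {V : Type*} [NormedAddCommGroup V]
    [InnerProductSpace ℝ V] [FiniteDimensional ℝ V] {T : V →ₗ[ℝ] V} (hT : T.IsSymmetric)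
    {k : ℕ} (hk : Module.finrank ℝ V = k) {a : ℝ} (ha : ∀ i, a ≤ hT.eigenvalues hk i) (v : V) :
    a * ‖v‖ ^ 2 ≤ ⟪T v, v⟫_ℝ := by
  set b := hT.eigenvectorBasis hk
  rw [← b.sum_inner_mul_inner, ← b.sum_sq_norm_inner_right v, Finset.mul_sum]
  refine Finset.sum_le_sum fun i _ => ?_
  have h : ⟪T v, b i⟫_ℝ = hT.eigenvalues hk i * ⟪b i, v⟫_ℝ := by
    rw [hT v (b i), hT.apply_eigenvectorBasis, inner_smul_right, real_inner_comm]
    rfl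
  rw [h, Real.norm_eq_abs, sq_abs, mul_assoc, ← sq]
  exact mul_le_mul_of_nonneg_right (ha i) (sq_nonneg _)

theorem toEuclideanLin_jac (c : Fin m → E n → ℝ) (x : E n) (μ : Fin m → ℝ) :
    Matrix.toEuclideanLin (jac c x) (WithLp.toLp 2 μ) = ∑ i, μ i • gradient (c i) x := by
  ext j
  simp [Matrix.mulVec, dotProduct, jac, mul_comm]

/-- A lower bound on the singular values of `∇c(x)` bounds the coefficients of a normal vector
by its norm. -/
theorem SigmaMinGE.mul_abs_le {c : Fin m → E n → ℝ} {x : E n} {s : ℝ} (hs : 0 ≤ s)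
    (h : SigmaMinGE c x s) (μ : Fin m → ℝ) (i : Fin m) :
    s * |μ i| ≤ ‖∑ i, μ i • gradient (c i) x‖ := by
  set A := Matrix.toEuclideanLin (jac c x)
  have hk : Module.finrank ℝ (EuclideanSpace ℝ (Fin m)) = m := by simp
  have h1 := mul_norm_sq_le_inner_of_le_eigenvalues A.isSymmetric_adjoint_comp_self hk
    (a := s ^ 2) (fun i => by
      rw [← A.sq_singularValues_fin hk]
      exact pow_le_pow_left₀ hs (h i) 2) (WithLp.toLp 2 μ)
  rw [LinearMap.comp_apply, LinearMap.adjoint_inner_left, real_inner_self_eq_norm_sq,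
    toEuclideanLin_jac, ← mul_pow] at h1
  refine le_trans ?_ (le_of_sq_le_sq h1 (norm_nonneg _))
  exact mul_le_mul_of_nonneg_left (PiLp.norm_apply_le (WithLp.toLp 2 μ) i) hs

/-- For `n ≥ 1` the number `minEig T` is an eigenvalue of the symmetric operator `T`. -/
theorem hasEigenvalue_minEig (hn : 0 < n) {T : E n →L[ℝ] E n}
    (hT : (T : E n →ₗ[ℝ] E n).IsSymmetric) :
    Module.End.HasEigenvalue (T : E n →ₗ[ℝ] E n) (minEig T) := by
  have hk : Module.finrank ℝ (E n) = n := by simp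
  have hne : {μ : ℝ | Module.End.HasEigenvalue (T : E n →ₗ[ℝ] E n) μ}.Nonempty :=
    ⟨_, hT.hasEigenvalue_eigenvalues hk ⟨0, hn⟩⟩
  have hfin : {μ : ℝ | Module.End.HasEigenvalue (T : E n →ₗ[ℝ] E n) μ}.Finite :=
    Module.End.finite_hasEigenvalue _
  exact hne.csInf_mem hfin

theorem minEig_mul_norm_sq_le_inner {T : E n →L[ℝ] E n}
    (hT : (T : E n →ₗ[ℝ] E n).IsSymmetric) (v : E n) :
    minEig T * ‖v‖ ^ 2 ≤ ⟪T v, v⟫_ℝ := by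
  have hk : Module.finrank ℝ (E n) = n := by simp
  have hfin : {μ : ℝ | Module.End.HasEigenvalue (T : E n →ₗ[ℝ] E n) μ}.Finite :=
    Module.End.finite_hasEigenvalue _
  exact mul_norm_sq_le_inner_of_le_eigenvalues hT hk
    (fun i => csInf_le hfin.bddBelow (hT.hasEigenvalue_eigenvalues hk i)) v

/-! ### Gradients, Hessians and Taylor estimates -/

theorem contDiff_gradient {g : E n → ℝ} (hg : ContDiff ℝ 2 g) : ContDiff ℝ 1 (gradient g) :=
  (InnerProductSpace.toDual ℝ (E n)).symm.contDiff.comp (hg.fderiv_right (m := 1) le_rfl)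

theorem hasFDerivAt_gradient {g : E n → ℝ} (hg : ContDiff ℝ 2 g) (x : E n) :
    HasFDerivAt (gradient g) (hess g x) x :=
  ((contDiff_gradient hg).differentiable one_ne_zero x).hasFDerivAt

theorem hasGradientAt {g : E n → ℝ} (hg : ContDiff ℝ 2 g) (x : E n) :
    HasGradientAt g (gradient g x) x :=
  (hg.differentiable two_ne_zero x).hasGradientAt

theorem inner_hess {g : E n → ℝ} (hg : ContDiff ℝ 2 g) (x u v : E n) :
    ⟪hess g x u, v⟫_ℝ = fderiv ℝ (fderiv ℝ g) x u v := by
  have h2 : HasFDerivAt (fun y => ⟪gradient g y, v⟫_ℝ) _ x :=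
    (hasFDerivAt_gradient hg x).inner ℝ (hasFDerivAt_const v x)
  have h3 : HasFDerivAt (fun y => fderiv ℝ g y v) _ x :=
    ((hg.fderiv_right (m := 1) le_rfl).differentiable one_ne_zero x).hasFDerivAt.clm_apply
      (hasFDerivAt_const v x)
  have h4 : (fun y => ⟪gradient g y, v⟫_ℝ) = fun y => fderiv ℝ g y v := by
    ext y
    exact inner_gradient_left
  rw [h4] at h2
  have h5 := DFunLike.congr_fun (h2.unique h3) u
  simpa using h5

theorem isSymmetric_hess {g : E n → ℝ} (hg : ContDiff ℝ 2 g) (x : E n) :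
    (hess g x : E n →ₗ[ℝ] E n).IsSymmetric := by
  intro u v
  have h : IsSymmSndFDerivAt ℝ g x := hg.contDiffAt.isSymmSndFDerivAt (by simp)
  change ⟪hess g x u, v⟫_ℝ = ⟪u, hess g x v⟫_ℝ
  rw [inner_hess hg, real_inner_comm, inner_hess hg, h.eq]

/-- First-order Taylor estimate for a map whose derivative is Lipschitz from the base point along
the segment. -/
theorem norm_sub_sub_le_of_segment {V F : Type*} [NormedAddCommGroup V] [NormedSpace ℝ V]
    [NormedAddCommGroup F] [NormedSpace ℝ F] {g : V → F} {g' : V → V →L[ℝ] F}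
    (hg : ∀ z, HasFDerivAt g (g' z) z) {x y : V} {K : ℝ} (hK : 0 ≤ K)
    (hL : ∀ z ∈ segment ℝ x y, ‖g' z - g' x‖ ≤ K * ‖z - x‖) :
    ‖g y - g x - g' x (y - x)‖ ≤ K * ‖y - x‖ ^ 2 := by
  rw [sq, ← mul_assoc]
  refine (convex_segment x y).norm_image_sub_le_of_norm_hasFDerivWithin_le'
    (fun z _ => (hg z).hasFDerivWithinAt) (fun z hz => (hL z hz).trans ?_)
    (left_mem_segment ℝ x y) (right_mem_segment ℝ x y)
  exact mul_le_mul_of_nonneg_left (norm_sub_le_of_mem_segment hz) hK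

/-- Second-order Taylor estimate for a function whose Hessian is Lipschitz from the base point
along the segment. -/
theorem taylor_two_le {g : E n → ℝ} (hg : ContDiff ℝ 2 g) {x y : E n} {K : ℝ} (hK : 0 ≤ K)
    (hL : ∀ z ∈ segment ℝ x y, ‖hess g z - hess g x‖ ≤ K * ‖z - x‖) :
    g y - g x ≤ ⟪gradient g x, y - x⟫_ℝ + 1 / 2 * ⟪hess g x (y - x), y - x⟫_ℝ
      + K * ‖y - x‖ ^ 3 := by
  have key : ∀ z ∈ segment ℝ x y,
      ‖gradient g z - gradient g x - hess g x (z - x)‖ ≤ K * ‖y - x‖ ^ 2 := by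
    intro z hz
    refine (norm_sub_sub_le_of_segment (fun z => hasFDerivAt_gradient hg z) hK
      fun w hw => hL w ?_).trans ?_
    · exact (convex_segment x y).segment_subset (left_mem_segment ℝ x y) hz hw
    · gcongr
      exact norm_sub_le_of_mem_segment hz
  have hder : ∀ z, HasFDerivAt
      (fun z => g z - ⟪gradient g x, z - x⟫_ℝ - 1 / 2 * ⟪hess g x (z - x), z - x⟫_ℝ)
      (InnerProductSpace.toDual ℝ (E n)
        (gradient g z - gradient g x - hess g x (z - x))) z := by
    intro z
    have hid : HasFDerivAt (fun z : E n => z - x) (ContinuousLinearMap.id ℝ (E n)) z :=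
      (hasFDerivAt_id z).sub_const x
    have h1 : HasFDerivAt g _ z := (hasGradientAt hg z).hasFDerivAt
    have h2 : HasFDerivAt (fun z => ⟪gradient g x, z - x⟫_ℝ) _ z :=
      (hasFDerivAt_const (gradient g x) z).inner ℝ hid
    have h3 : HasFDerivAt (fun z => ⟪hess g x (z - x), z - x⟫_ℝ) _ z :=
      ((hess g x).hasFDerivAt.comp z hid).inner ℝ hid
    refine ((h1.sub h2).sub (h3.const_mul (1 / 2))).congr_fderiv ?_
    ext u
    have hs : ⟪hess g x u, z - x⟫_ℝ = ⟪u, hess g x (z - x)⟫_ℝ := isSymmetric_hess hg x u (z - x)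
    simp [hs, real_inner_comm u, inner_sub_right]
    ring
  have h := (convex_segment x y).norm_image_sub_le_of_norm_hasFDerivWithin_le
    (fun z _ => (hder z).hasFDerivWithinAt) (C := K * ‖y - x‖ ^ 2)
    (fun z hz => by rw [LinearIsometryEquiv.norm_map]; exact key z hz)
    (left_mem_segment ℝ x y) (right_mem_segment ℝ x y)
  have h' := (le_abs_self _).trans h
  simp only [sub_self, map_zero, inner_zero_right] at h'
  linarith

/-! ### The Lagrangian and the least-squares multiplier -/

section Lagrangian

variable {f : E n → ℝ} {c : Fin m → E n → ℝ} {lam : E n → Fin m → ℝ}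

theorem contDiff_lagrangian (hA : KeyAssumption f c) (μ : Fin m → ℝ) :
    ContDiff ℝ 2 (fun y => lagrangian f c y μ) :=
  hA.smooth_f.sub (ContDiff.sum fun i _ => contDiff_const.mul (hA.smooth_c i))

theorem gradL_eq (hA : KeyAssumption f c) (x : E n) (μ : Fin m → ℝ) :
    gradL f c x μ = gradient f x - ∑ i, μ i • gradient (c i) x := by
  refine HasGradientAt.gradient ?_
  rw [hasGradientAt_iff_hasFDerivAt, map_sub, map_sum]
  simp only [map_smul]
  exact (hasGradientAt hA.smooth_f x).hasFDerivAt.sub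
    (HasFDerivAt.fun_sum fun i _ => (hasGradientAt (hA.smooth_c i) x).hasFDerivAt.const_mul (μ i))

theorem hessL_eq (hA : KeyAssumption f c) (x : E n) (μ : Fin m → ℝ) :
    hessL f c x μ = hess f x - ∑ i, μ i • hess (c i) x := by
  have h : gradient (fun y => lagrangian f c y μ) =
      fun y => gradient f y - ∑ i, μ i • gradient (c i) y := funext fun y => gradL_eq hA y μ
  rw [hessL, hess, h]
  exact ((hasFDerivAt_gradient hA.smooth_f x).sub (HasFDerivAt.fun_sum fun i _ =>
    (hasFDerivAt_gradient (hA.smooth_c i) x).const_smul (μ i))).fderiv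

theorem genGrad_eq (hA : KeyAssumption f c) (x : E n) :
    genGrad f c lam x = gradient f x - ∑ i, lam x i • gradient (c i) x :=
  gradL_eq hA x _

/-- First-order optimality of the least-squares multiplier: the residual `𝒢(x)` is orthogonal to
the constraint gradients. -/
theorem inner_gradient_genGrad (hA : KeyAssumption f c) (hlam : IsMultiplier f c lam) {x : E n}
    (hx : x ∈ feasible c) (i : Fin m) : ⟪gradient (c i) x, genGrad f c lam x⟫_ℝ = 0 := by
  set G := genGrad f c lam x with hG
  set g := gradient (c i) x with hg
  have hmin : ∀ t : ℝ, ‖G‖ ^ 2 ≤ ‖G - t • g‖ ^ 2 := by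
    intro t
    have h := hlam x hx (lam x + Pi.single i t)
    have h2 : gradL f c x (lam x + Pi.single i t) = G - t • g := by
      rw [gradL_eq hA, hG, genGrad_eq hA]
      simp only [Pi.add_apply, add_smul, Finset.sum_add_distrib]
      rw [Finset.sum_eq_single i (f := fun j => (Pi.single i t : Fin m → ℝ) j • gradient (c j) x)
        (fun j _ hj => by simp [hj]) (by simp)]
      simp only [Pi.single_eq_same, hg]
      abel
    rw [h2] at h
    exact pow_le_pow_left₀ (norm_nonneg _) h 2
  -- the step `t = ⟨g, G⟩ / (‖g‖² + 1)` decreases the norm unless `⟨g, G⟩ = 0`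
  have h := hmin (⟪g, G⟫_ℝ / (‖g‖ ^ 2 + 1))
  rw [norm_sub_sq_real, norm_smul, mul_pow, Real.norm_eq_abs, sq_abs, inner_smul_right,
    real_inner_comm g G] at h
  set a := ⟪g, G⟫_ℝ
  have hb : (0 : ℝ) < ‖g‖ ^ 2 + 1 := by positivity
  have e : ‖G‖ ^ 2 - 2 * (a / (‖g‖ ^ 2 + 1) * a) + (a / (‖g‖ ^ 2 + 1)) ^ 2 * ‖g‖ ^ 2 =
      ‖G‖ ^ 2 - (a / (‖g‖ ^ 2 + 1)) ^ 2 * (‖g‖ ^ 2 + 2) := by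
    field_simp
    ring
  rw [e] at h
  have h3 : (a / (‖g‖ ^ 2 + 1)) ^ 2 = 0 := by
    nlinarith [sq_nonneg (a / (‖g‖ ^ 2 + 1)), sq_nonneg ‖g‖,
      mul_nonneg (sq_nonneg (a / (‖g‖ ^ 2 + 1))) (sq_nonneg ‖g‖)]
  have h4 := pow_eq_zero_iff (two_ne_zero) |>.mp h3
  exact (div_eq_zero_iff.mp h4).resolve_right hb.ne'

theorem mem_tangentSpace_iff {x u : E n} :
    u ∈ tangentSpace c x ↔ ∀ i, ⟪gradient (c i) x, u⟫_ℝ = 0 := by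
  rw [tangentSpace, Submodule.mem_orthogonal]
  constructor
  · exact fun h i => h _ (Submodule.subset_span ⟨i, rfl⟩)
  · intro h v hv
    induction hv using Submodule.span_induction with
    | mem _ hv =>
      obtain ⟨i, rfl⟩ := hv
      exact h i
    | zero => simp
    | add a b _ _ ha hb => rw [inner_add_left, ha, hb, add_zero]
    | smul t a _ ha => rw [inner_smul_left, ha, mul_zero]

theorem genGrad_mem_tangentSpace (hA : KeyAssumption f c) (hlam : IsMultiplier f c lam) {x : E n}
    (hx : x ∈ feasible c) : genGrad f c lam x ∈ tangentSpace c x :=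
  mem_tangentSpace_iff.mpr (inner_gradient_genGrad hA hlam hx)

theorem norm_genGrad_le (hA : KeyAssumption f c) (hlam : IsMultiplier f c lam) {x : E n}
    (hx : x ∈ feasible c) : ‖genGrad f c lam x‖ ≤ ‖gradient f x‖ := by
  have h := hlam x hx 0
  rw [gradL_eq hA x 0] at h
  simpa [genGrad] using h

theorem tanProj_of_mem {x u : E n} (hu : u ∈ tangentSpace c x) : tanProj c x u = u :=
  Submodule.starProjection_eq_self_iff.mpr hu

theorem tanProj_mem (x u : E n) : tanProj c x u ∈ tangentSpace c x :=
  Submodule.starProjection_apply_mem _ _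

theorem inner_genHess (x u v : E n) :
    ⟪genHess f c lam x u, v⟫_ℝ = ⟪hessL f c x (lam x) (tanProj c x u), tanProj c x v⟫_ℝ := by
  simp [genHess, ContinuousLinearMap.adjoint_inner_left]

theorem inner_genHess_of_mem {x u v : E n} (hu : u ∈ tangentSpace c x)
    (hv : v ∈ tangentSpace c x) :
    ⟪genHess f c lam x u, v⟫_ℝ = ⟪hessL f c x (lam x) u, v⟫_ℝ := by
  rw [inner_genHess, tanProj_of_mem hu, tanProj_of_mem hv]

theorem isSymmetric_genHess (hA : KeyAssumption f c) (x : E n) :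
    (genHess f c lam x : E n →ₗ[ℝ] E n).IsSymmetric := by
  intro u v
  change ⟪genHess f c lam x u, v⟫_ℝ = ⟪u, genHess f c lam x v⟫_ℝ
  rw [real_inner_comm _ u, inner_genHess, inner_genHess,
    real_inner_comm _ (hessL f c x (lam x) (tanProj c x v))]
  exact isSymmetric_hess (contDiff_lagrangian hA (lam x)) x _ _

/-- Eigenvectors of `ℋ(x)` for nonzero eigenvalues are tangent. -/
theorem mem_tangentSpace_of_genHess_eq {x v : E n} {μ : ℝ} (hμ : μ ≠ 0)
    (h : genHess f c lam x v = μ • v) : v ∈ tangentSpace c x := by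
  have hv : v = μ⁻¹ • genHess f c lam x v := by rw [h, smul_smul, inv_mul_cancel₀ hμ, one_smul]
  have hP : ContinuousLinearMap.adjoint (tanProj c x) = tanProj c x :=
    (isSelfAdjoint_starProjection _).adjoint_eq
  rw [hv, genHess, hP]
  exact Submodule.smul_mem _ _ (tanProj_mem x _)

end Lagrangian

/-! ### Constants that are uniform over the feasible set -/

/-- `M` serves as a bound, uniform over the feasible set, for the Lipschitz constants of the
constraint gradients, for the inverse of the smallest singular value of `∇c`, and for the size and
the Lipschitz constants of the derivatives of the Lagrangian at the least-squares multiplier. -/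
structure UniformBound (f : E n → ℝ) (c : Fin m → E n → ℝ) (lam : E n → Fin m → ℝ) (M : ℝ) :
    Prop where
  nonneg : 0 ≤ M
  lip_grad_c : ∀ i, ∀ x ∈ feasible c, ∀ y ∈ feasible c, ∀ z ∈ segment ℝ x y,
    ‖gradient (c i) z - gradient (c i) x‖ ≤ M * ‖z - x‖
  coeff_le : ∀ x ∈ feasible c, ∀ (μ : Fin m → ℝ) (i : Fin m),
    |μ i| ≤ M * ‖∑ i, μ i • gradient (c i) x‖
  genGrad_le : ∀ x ∈ feasible c, ‖genGrad f c lam x‖ ≤ M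
  hessL_le : ∀ x ∈ feasible c, ‖hessL f c x (lam x)‖ ≤ M
  lip_hessL : ∀ x ∈ feasible c, ∀ y ∈ feasible c, ∀ z ∈ segment ℝ x y,
    ‖hessL f c z (lam x) - hessL f c x (lam x)‖ ≤ M * ‖z - x‖

/-- Finitely many constants for monotone conditions can be replaced by a common one. -/
theorem exists_forall_le_of_forall_exists {P : Fin m → ℝ → Prop}
    (hP : ∀ i a b, a ≤ b → P i a → P i b) (h : ∀ i, ∃ a, P i a) :
    ∃ a, 0 ≤ a ∧ ∀ i, P i a := by
  choose a ha using h
  exact ⟨∑ i, |a i|, Finset.sum_nonneg fun i _ => abs_nonneg _, fun i => hP i _ _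
    ((le_abs_self _).trans (Finset.single_le_sum (f := fun i => |a i|)
      (fun i _ => abs_nonneg _) (Finset.mem_univ i))) (ha i)⟩

theorem norm_sum_smul_le {F : Type*} [NormedAddCommGroup F] [NormedSpace ℝ F] {μ : Fin m → ℝ}
    {T : Fin m → F} {a b : ℝ} (ha : 0 ≤ a) (hμ : ∀ i, |μ i| ≤ a) (hT : ∀ i, ‖T i‖ ≤ b) :
    ‖∑ i, μ i • T i‖ ≤ m * (a * b) := by
  refine (norm_sum_le _ _).trans ?_
  calc ∑ i, ‖μ i • T i‖ ≤ ∑ _i : Fin m, a * b := by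
        refine Finset.sum_le_sum fun i _ => ?_
        rw [norm_smul, Real.norm_eq_abs]
        exact mul_le_mul (hμ i) (hT i) (norm_nonneg _) ha
    _ = m * (a * b) := by simp

theorem exists_uniformBound {f : E n → ℝ} {c : Fin m → E n → ℝ} {lam : E n → Fin m → ℝ}
    (hA : KeyAssumption f c) (hlam : IsMultiplier f c lam) : ∃ M, UniformBound f c lam M := by
  obtain ⟨L₁, hL₁⟩ := hA.lip_hess_f
  obtain ⟨L₂, hL₂0, hL₂⟩ := exists_forall_le_of_forall_exists (fun i a b hab h x hx y hy z hz =>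
    (h x hx y hy z hz).trans (mul_le_mul_of_nonneg_right hab (norm_nonneg _))) hA.lip_grad_c
  obtain ⟨L₃, hL₃0, hL₃⟩ := exists_forall_le_of_forall_exists (fun i a b hab h x hx y hy z hz =>
    (h x hx y hy z hz).trans (mul_le_mul_of_nonneg_right hab (norm_nonneg _))) hA.lip_hess_c
  obtain ⟨γ₁, hγ₁⟩ := hA.bdd_grad_f
  obtain ⟨γ₂, hγ₂⟩ := hA.bdd_hess_f
  obtain ⟨γ₃, hγ₃0, hγ₃⟩ := exists_forall_le_of_forall_exists (fun i a b hab h x hx =>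
    (h x hx).trans hab) hA.bdd_hess_c
  obtain ⟨σ₀, hσ₀, hσ⟩ := hA.licq
  have hcoeff : ∀ x ∈ feasible c, ∀ (μ : Fin m → ℝ) (i : Fin m),
      |μ i| ≤ σ₀⁻¹ * ‖∑ i, μ i • gradient (c i) x‖ := by
    intro x hx μ i
    rw [inv_mul_eq_div, le_div_iff₀' hσ₀]
    exact (hσ x hx).mul_abs_le hσ₀.le μ i
  have hG : ∀ x ∈ feasible c, ‖genGrad f c lam x‖ ≤ γ₁ := fun x hx =>
    (norm_genGrad_le hA hlam hx).trans (hγ₁ x hx)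
  set Λ := σ₀⁻¹ * (2 * |γ₁|) with hΛ
  have hΛ0 : 0 ≤ Λ := by positivity
  have hlamb : ∀ x ∈ feasible c, ∀ i, |lam x i| ≤ Λ := by
    intro x hx i
    refine (hcoeff x hx (lam x) i).trans (mul_le_mul_of_nonneg_left ?_ (by positivity))
    have h : ∑ i, lam x i • gradient (c i) x = gradient f x - genGrad f c lam x := by
      rw [genGrad_eq hA]
      abel
    rw [h]
    have := norm_sub_le (gradient f x) (genGrad f c lam x)
    linarith [hγ₁ x hx, hG x hx, le_abs_self γ₁]
  have hb1 : 0 ≤ m * (Λ * γ₃) := by positivity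
  have hb2 : 0 ≤ m * (Λ * L₃) := by positivity
  have hs0 : 0 ≤ σ₀⁻¹ := by positivity
  refine ⟨L₂ + σ₀⁻¹ + |γ₁| + (|γ₂| + m * (Λ * γ₃)) + (|L₁| + m * (Λ * L₃)), ?_, ?_, ?_, ?_, ?_, ?_⟩
  · positivity
  · intro i x hx y hy z hz
    refine (hL₂ i x hx y hy z hz).trans (mul_le_mul_of_nonneg_right ?_ (norm_nonneg _))
    linarith [abs_nonneg γ₁, abs_nonneg γ₂, abs_nonneg L₁]
  · intro x hx μ i
    refine (hcoeff x hx μ i).trans (mul_le_mul_of_nonneg_right ?_ (norm_nonneg _))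
    linarith [abs_nonneg γ₁, abs_nonneg γ₂, abs_nonneg L₁]
  · intro x hx
    linarith [hG x hx, le_abs_self γ₁, abs_nonneg γ₂, abs_nonneg L₁]
  · intro x hx
    rw [hessL_eq hA]
    have h1 := norm_sum_smul_le hΛ0 (hlamb x hx) (fun i => hγ₃ i x hx)
    have h2 := norm_sub_le (hess f x) (∑ i, lam x i • hess (c i) x)
    linarith [hγ₂ x hx, le_abs_self γ₂, abs_nonneg γ₁, abs_nonneg L₁]
  · intro x hx y hy z hz
    have h0 : ∑ i, lam x i • hess (c i) z - ∑ i, lam x i • hess (c i) x =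
        ∑ i, lam x i • (hess (c i) z - hess (c i) x) := by
      rw [← Finset.sum_sub_distrib]
      exact Finset.sum_congr rfl fun i _ => (smul_sub _ _ _).symm
    rw [hessL_eq hA, hessL_eq hA, sub_sub_sub_comm, h0]
    have h1 := norm_sum_smul_le hΛ0 (hlamb x hx) (fun i => hL₃ i x hx y hy z hz)
    have h2 := norm_sub_le (hess f z - hess f x)
      (∑ i, lam x i • (hess (c i) z - hess (c i) x))
    have h3 := hL₁ x hx y hy z hz
    have h4 : 0 ≤ ‖z - x‖ := norm_nonneg _
    calc _ ≤ L₁ * ‖z - x‖ + m * (Λ * (L₃ * ‖z - x‖)) := by linarith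
      _ = (L₁ + m * (Λ * L₃)) * ‖z - x‖ := by ring
      _ ≤ _ := by
        refine mul_le_mul_of_nonneg_right ?_ h4
        linarith [le_abs_self L₁, abs_nonneg γ₁, abs_nonneg γ₂]

/-! ### The projection onto the feasible set as a retraction -/

section Retraction

variable {f : E n → ℝ} {c : Fin m → E n → ℝ} {lam : E n → Fin m → ℝ} {Pi : E n → E n} {M : ℝ}

/-- The multiplier rule for the closest point: `y - Π(y)` is normal to the feasible set
at `Π(y)`. -/
theorem exists_sub_proj_eq_sum (hA : KeyAssumption f c) (hM : UniformBound f c lam M)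
    (hPi : IsProj (feasible c) Pi) (y : E n) :
    ∃ w : Fin m → ℝ, Pi y - y = ∑ i, w i • gradient (c i) (Pi y) := by
  set z := Pi y with hz
  have hzΩ : z ∈ feasible c := (hPi y).1
  have hφ : HasStrictFDerivAt (fun u : E n => ‖u - y‖ ^ 2)
      (InnerProductSpace.toDual ℝ (E n) ((2 : ℝ) • (z - y))) z := by
    have h := (hasStrictFDerivAt_norm_sq (z - y)).comp z ((hasStrictFDerivAt_id z).sub_const y)
    refine h.congr_fderiv ?_
    ext u
    simp
  have hext : IsLocalExtrOn (fun u : E n => ‖u - y‖ ^ 2) {u | ∀ i, c i u = c i z} z := by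
    refine Or.inl (IsMinOn.localize fun u hu => ?_)
    exact pow_le_pow_left₀ (norm_nonneg _) ((hPi y).2 u fun i => (hu i).trans (hzΩ i)) 2
  obtain ⟨Λ, Λ₀, hne, hsum⟩ := hext.exists_multipliers_of_hasStrictFDerivAt
    (f' := fun i => InnerProductSpace.toDual ℝ (E n) (gradient (c i) z)) (fun i => by
      rw [toDual_gradient]
      exact (hA.smooth_c i).contDiffAt.hasStrictFDerivAt two_ne_zero) hφ
  have hsum' : ∑ i, Λ i • gradient (c i) z + Λ₀ • (2 : ℝ) • (z - y) = 0 := by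
    apply (InnerProductSpace.toDual ℝ (E n)).injective
    rw [map_zero, ← hsum, map_add, map_sum]
    simp
  -- the constraint gradients at `z` are independent, so the multiplier of `‖· - y‖²` is nonzero
  have hΛ₀ : Λ₀ ≠ 0 := by
    rintro rfl
    refine hne (Prod.ext (funext fun i => ?_) rfl)
    rw [zero_smul, add_zero] at hsum'
    have h := hM.coeff_le z hzΩ Λ i
    rw [hsum', norm_zero, mul_zero] at h
    exact abs_eq_zero.mp (le_antisymm h (abs_nonneg _))
  refine ⟨fun i => -(Λ₀ * 2)⁻¹ * Λ i, ?_⟩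
  simp only [mul_smul, ← Finset.smul_sum]
  rw [eq_neg_of_add_eq_zero_left hsum', smul_neg, neg_smul, neg_neg, smul_smul, smul_smul,
    mul_assoc, inv_mul_cancel₀ (mul_ne_zero hΛ₀ two_ne_zero), one_smul]

theorem le_of_mul_self_le_mul {a b : ℝ} (hb : 0 ≤ b) (h : a * a ≤ a * b) : a ≤ b := by
  by_contra hlt
  nlinarith

theorem norm_proj_sub_le (hPi : IsProj (feasible c) Pi) {x : E n} (hx : x ∈ feasible c)
    (s : E n) : ‖Pi (x + s) - (x + s)‖ ≤ ‖s‖ := by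
  simpa using (hPi (x + s)).2 x hx

theorem norm_proj_sub_base_le (hPi : IsProj (feasible c) Pi) {x : E n} (hx : x ∈ feasible c)
    (s : E n) : ‖Pi (x + s) - x‖ ≤ 2 * ‖s‖ := by
  have h : Pi (x + s) - x = (Pi (x + s) - (x + s)) + s := by abel
  rw [h]
  linarith [norm_add_le (Pi (x + s) - (x + s)) s, norm_proj_sub_le hPi hx s]

/-- The correction that the projection adds to a tangent step is of second order. -/
theorem norm_proj_sub_le_sq (hA : KeyAssumption f c) (hM : UniformBound f c lam M)
    (hPi : IsProj (feasible c) Pi) {x s : E n} (hx : x ∈ feasible c)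
    (hs : s ∈ tangentSpace c x) :
    ‖Pi (x + s) - (x + s)‖ ≤ 6 * m * M ^ 2 * ‖s‖ ^ 2 := by
  obtain ⟨w, hw⟩ := exists_sub_proj_eq_sum hA hM hPi (x + s)
  have hr := norm_proj_sub_le hPi hx s
  have hd := norm_proj_sub_base_le hPi hx s
  have hzΩ : Pi (x + s) ∈ feasible c := (hPi (x + s)).1
  set z := Pi (x + s)
  set r := z - (x + s) with hrdef
  have hM0 := hM.nonneg
  have hbase : ∀ i, |⟪gradient (c i) x, r⟫_ℝ| ≤ 4 * M * ‖s‖ ^ 2 := by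
    intro i
    have h := norm_sub_sub_le_of_segment (x := x) (y := z) (K := M)
      (fun u => ((hA.smooth_c i).differentiable two_ne_zero u).hasFDerivAt) hM0 (fun u hu => by
        rw [← toDual_gradient, ← toDual_gradient, ← map_sub, LinearIsometryEquiv.norm_map]
        exact hM.lip_grad_c i x hx z hzΩ u hu)
    have h1 : fderiv ℝ (c i) x (z - x) = ⟪gradient (c i) x, r⟫_ℝ := by
      have h2 : z - x = r + s := by rw [hrdef]; abel
      rw [← inner_gradient_left, h2, inner_add_right, mem_tangentSpace_iff.mp hs i, add_zero]
    rw [hzΩ i, hx i, h1, sub_self, zero_sub, norm_neg, Real.norm_eq_abs] at h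
    refine h.trans ?_
    have : ‖z - x‖ ^ 2 ≤ (2 * ‖s‖) ^ 2 := pow_le_pow_left₀ (norm_nonneg _) hd 2
    nlinarith
  have hend : ∀ i, ‖⟪gradient (c i) z, r⟫_ℝ‖ ≤ 6 * M * ‖s‖ ^ 2 := by
    intro i
    have h1 : ⟪gradient (c i) z, r⟫_ℝ =
        ⟪gradient (c i) x, r⟫_ℝ + ⟪gradient (c i) z - gradient (c i) x, r⟫_ℝ := by
      rw [inner_sub_left]
      ring
    have h2 := hM.lip_grad_c i x hx z hzΩ z (right_mem_segment ℝ x z)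
    have h3 : ‖gradient (c i) z - gradient (c i) x‖ * ‖r‖ ≤ (M * (2 * ‖s‖)) * ‖s‖ :=
      mul_le_mul (h2.trans (mul_le_mul_of_nonneg_left hd hM0)) hr (norm_nonneg _) (by positivity)
    rw [h1, Real.norm_eq_abs]
    refine (abs_add_le _ _).trans ?_
    have h4 := abs_real_inner_le_norm (gradient (c i) z - gradient (c i) x) r
    nlinarith [hbase i]
  have hsq : ‖r‖ ^ 2 ≤ ‖r‖ * (6 * m * M ^ 2 * ‖s‖ ^ 2) := by
    have h1 : ‖r‖ ^ 2 = ∑ i, w i • ⟪gradient (c i) z, r⟫_ℝ := by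
      rw [← real_inner_self_eq_norm_sq]
      nth_rw 1 [hw]
      simp [sum_inner, inner_smul_left]
    have h2 := norm_sum_smul_le (mul_nonneg hM0 (norm_nonneg r))
      (fun i => (hM.coeff_le z hzΩ w i).trans (by rw [← hw])) hend
    rw [← h1, Real.norm_of_nonneg (sq_nonneg _)] at h2
    refine h2.trans_eq ?_
    ring
  rw [sq] at hsq
  exact le_of_mul_self_le_mul (by positivity) hsq

/-- The tangential part of the correction is of third order, because the correction is normal at
the projected point, where the normal space differs from that at `x` by `O(‖s‖)`. -/
theorem inner_proj_sub_le (hA : KeyAssumption f c) (hM : UniformBound f c lam M)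
    (hPi : IsProj (feasible c) Pi) {x s u : E n} (hx : x ∈ feasible c)
    (hs : s ∈ tangentSpace c x) (hu : u ∈ tangentSpace c x) :
    ⟪u, Pi (x + s) - (x + s)⟫_ℝ ≤ 12 * m ^ 2 * M ^ 4 * ‖u‖ * ‖s‖ ^ 3 := by
  obtain ⟨w, hw⟩ := exists_sub_proj_eq_sum hA hM hPi (x + s)
  have hr := norm_proj_sub_le_sq hA hM hPi hx hs
  have hd := norm_proj_sub_base_le hPi hx s
  have hzΩ : Pi (x + s) ∈ feasible c := (hPi (x + s)).1
  set z := Pi (x + s)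
  set r := z - (x + s)
  have hM0 := hM.nonneg
  have h1 : ⟪u, r⟫_ℝ = ∑ i, w i • ⟪u, gradient (c i) z - gradient (c i) x⟫_ℝ := by
    rw [hw, inner_sum]
    refine Finset.sum_congr rfl fun i _ => ?_
    rw [inner_smul_right, inner_sub_right, real_inner_comm _ u, real_inner_comm _ u,
      mem_tangentSpace_iff.mp hu i, sub_zero, smul_eq_mul]
  have h2 : ∀ i, ‖⟪u, gradient (c i) z - gradient (c i) x⟫_ℝ‖ ≤ ‖u‖ * (M * (2 * ‖s‖)) := by
    intro i
    refine (norm_inner_le_norm _ _).trans (mul_le_mul_of_nonneg_left ?_ (norm_nonneg _))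
    exact (hM.lip_grad_c i x hx z hzΩ z (right_mem_segment ℝ x z)).trans
      (mul_le_mul_of_nonneg_left hd hM0)
  have h3 : ∀ i, |w i| ≤ M * (6 * m * M ^ 2 * ‖s‖ ^ 2) := fun i =>
    (hM.coeff_le z hzΩ w i).trans (by rw [← hw]; exact mul_le_mul_of_nonneg_left hr hM0)
  have h4 := norm_sum_smul_le (by positivity) h3 h2
  rw [← h1] at h4
  refine ((le_abs_self _).trans h4).trans_eq ?_
  ring

/-- Third-order expansion of `f` along the projected tangent steps, with an error constant that is
uniform over the feasible set. Since the constraints vanish at both ends, `f` may be replaced by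
the Lagrangian. -/
theorem exists_descent_bound (hA : KeyAssumption f c) (hlam : IsMultiplier f c lam)
    (hM : UniformBound f c lam M) (hPi : IsProj (feasible c) Pi) :
    ∃ K, 0 ≤ K ∧ ∀ x ∈ feasible c, ∀ s ∈ tangentSpace c x,
      f (Pi (x + s)) - f x ≤ ⟪genGrad f c lam x, s⟫_ℝ
        + 1 / 2 * ⟪genHess f c lam x s, s⟫_ℝ + K * ‖s‖ ^ 3 := by
  have hM0 := hM.nonneg
  refine ⟨12 * m ^ 2 * M ^ 4 * M + 3 * M * (6 * m * M ^ 2) + 8 * M, by positivity, ?_⟩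
  intro x hx s hs
  have hr1 := norm_proj_sub_le hPi hx s
  have hr2 := norm_proj_sub_le_sq hA hM hPi hx hs
  have hd := norm_proj_sub_base_le hPi hx s
  have hG := inner_proj_sub_le hA hM hPi hx hs (genGrad_mem_tangentSpace hA hlam hx)
  have hzΩ : Pi (x + s) ∈ feasible c := (hPi (x + s)).1
  have htay := taylor_two_le (contDiff_lagrangian hA (lam x)) hM0
    (hM.lip_hessL x hx (Pi (x + s)) hzΩ)
  have hGn := hM.genGrad_le x hx
  have hHn := hM.hessL_le x hx
  rw [inner_genHess_of_mem hs hs]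
  set z := Pi (x + s)
  set r := z - (x + s) with hr
  have hf : ∀ y ∈ feasible c, lagrangian f c y (lam x) = f y := fun y hy => by
    simp [lagrangian, hy _]
  rw [hf z hzΩ, hf x hx] at htay
  change _ ≤ ⟪genGrad f c lam x, z - x⟫_ℝ +
    1 / 2 * ⟪hessL f c x (lam x) (z - x), z - x⟫_ℝ + M * ‖z - x‖ ^ 3 at htay
  set A := hessL f c x (lam x)
  have hA1 : ∀ u v, |⟪A u, v⟫_ℝ| ≤ M * ‖u‖ * ‖v‖ := fun u v =>
    (abs_real_inner_le_norm _ _).trans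
      (mul_le_mul_of_nonneg_right (A.le_of_opNorm_le hHn u) (norm_nonneg _))
  have hzx : z - x = s + r := by rw [hr]; abel
  have e1 : ⟪genGrad f c lam x, z - x⟫_ℝ ≤
      ⟪genGrad f c lam x, s⟫_ℝ + 12 * m ^ 2 * M ^ 4 * M * ‖s‖ ^ 3 := by
    rw [hzx, inner_add_right]
    have : 12 * m ^ 2 * M ^ 4 * ‖genGrad f c lam x‖ * ‖s‖ ^ 3 ≤
      12 * m ^ 2 * M ^ 4 * M * ‖s‖ ^ 3 := by gcongr
    linarith
  have e2 : ⟪A (z - x), z - x⟫_ℝ ≤ ⟪A s, s⟫_ℝ + 3 * M * (6 * m * M ^ 2) * ‖s‖ ^ 3 := by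
    have h1 : ⟪A (z - x), z - x⟫_ℝ = ⟪A s, s⟫_ℝ + ⟪A s, r⟫_ℝ + ⟪A r, z - x⟫_ℝ := by
      rw [hzx, map_add, inner_add_left, inner_add_right]
    have h2 : ⟪A s, r⟫_ℝ ≤ M * ‖s‖ * (6 * m * M ^ 2 * ‖s‖ ^ 2) :=
      (le_abs_self _).trans ((hA1 s r).trans (by gcongr))
    have h3 : ⟪A r, z - x⟫_ℝ ≤ M * (6 * m * M ^ 2 * ‖s‖ ^ 2) * (2 * ‖s‖) :=
      (le_abs_self _).trans ((hA1 r (z - x)).trans (by gcongr))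
    rw [h1]
    linarith
  have e3 : ‖z - x‖ ^ 3 ≤ 8 * ‖s‖ ^ 3 := by
    have : ‖z - x‖ ^ 3 ≤ (2 * ‖s‖) ^ 3 := pow_le_pow_left₀ (norm_nonneg _) hd 3
    linarith
  have e4 := mul_le_mul_of_nonneg_left e3 hM0
  have e5 : 0 ≤ 3 * M * (6 * m * M ^ 2) * ‖s‖ ^ 3 := by positivity
  nlinarith

end Retraction

/-! ### Line searches -/

section LineSearch

variable {p : Params} {f : E n → ℝ} {c : Fin m → E n → ℝ} {lam : E n → Fin m → ℝ}
  {Pi : E n → E n} {M : ℝ}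

theorem Backtrack.exists_of_forall_le {test : ℝ → Prop} {b : ℝ} (hb : 0 < b)
    (h : ∀ t, 0 < t → t ≤ b → test t) : ∃ t, Backtrack p test t := by
  classical
  have hex : ∃ j : ℕ, test (p.t₀ * p.ρ ^ j) := by
    obtain ⟨j, hj⟩ := exists_pow_lt_of_lt_one (div_pos hb p.t₀_pos) p.ρ_lt
    refine ⟨j, h _ (mul_pos p.t₀_pos (pow_pos p.ρ_pos j)) ?_⟩
    rw [mul_comm]
    exact ((lt_div_iff₀ p.t₀_pos).mp hj).le
  exact ⟨_, Nat.find hex, rfl, Nat.find_spec hex, fun i hi => Nat.find_min hex hi⟩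

/-- If every step size up to `b` passes the test, then the backtracking loop, whose last rejected
value exceeds `b`, stops no lower than `min t₀ (ρ b)`. -/
theorem Backtrack.min_le {test : ℝ → Prop} {b t : ℝ}
    (h : ∀ t, 0 < t → t ≤ b → test t) (ht : Backtrack p test t) :
    min p.t₀ (p.ρ * b) ≤ t := by
  obtain ⟨j, rfl, -, hj⟩ := ht
  rcases j with _ | j
  · simp
  · have hlt : b < p.t₀ * p.ρ ^ j := by
      by_contra hle
      exact hj j j.lt_succ_self (h _ (mul_pos p.t₀_pos (pow_pos p.ρ_pos j)) (not_lt.mp hle))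
    refine (min_le_right _ _).trans ?_
    rw [pow_succ, ← mul_assoc, mul_comm p.ρ]
    exact mul_le_mul_of_nonneg_right hlt.le p.ρ_pos.le

/-- The properties of a search direction `d` of negative curvature that the descent estimate uses,
with `l = |min {λ_min(ℋ(x)), 0}|`: it is tangent, it is a direction of nonincrease, its length is
`l`, and `ℋ(x) d = -l d`. All of this holds trivially when `l = 0`, since then `d = 0`. -/
theorem IsDirection.properties {x d : E n} (hd : IsDirection f c lam x d) :
    d ∈ tangentSpace c x ∧ ⟪genGrad f c lam x, d⟫_ℝ ≤ 0 ∧ ‖d‖ = |negEig f c lam x| ∧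
      genHess f c lam x d = (-|negEig f c lam x|) • d := by
  obtain ⟨v, s, hv, hev, hs, hsign, rfl⟩ := hd
  rcases le_or_gt 0 (minEig (genHess f c lam x)) with h | h
  · have h0 : negEig f c lam x = 0 := min_eq_right h
    simp [h0]
  · have h0 : negEig f c lam x = minEig (genHess f c lam x) := min_eq_left h.le
    have habs : |s| = 1 := by rcases hs with rfl | rfl <;> simp
    refine ⟨Submodule.smul_mem _ _ (mem_tangentSpace_of_genHess_eq h.ne hev), ?_, ?_, ?_⟩
    · rw [inner_smul_right, real_inner_comm, mul_assoc]
      exact mul_nonpos_of_nonneg_of_nonpos (abs_nonneg _) (by linarith)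
    · rw [norm_smul, hv, Real.norm_eq_abs, abs_mul, abs_abs, habs, mul_one, mul_one]
    · rw [map_smul, hev, smul_comm, h0, abs_of_neg h, neg_neg]

theorem exists_isDirection (hn : 0 < n) (hA : KeyAssumption f c) (x : E n) :
    ∃ d, IsDirection f c lam x d := by
  obtain ⟨v, hv⟩ :=
    (hasEigenvalue_minEig hn (isSymmetric_genHess (lam := lam) hA x)).exists_hasEigenvector
  have hv0 : ‖v‖ ≠ 0 := norm_ne_zero_iff.mpr hv.2
  have hev : genHess f c lam x v = minEig (genHess f c lam x) • v := hv.apply_eq_smul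
  have hev' : genHess f c lam x (‖v‖⁻¹ • v) =
      minEig (genHess f c lam x) • (‖v‖⁻¹ • v) := by
    rw [map_smul, hev, smul_comm]
  have hnorm : ‖‖v‖⁻¹ • v‖ = 1 := by
    rw [norm_smul, norm_inv, norm_norm, inv_mul_cancel₀ hv0]
  rcases le_total 0 (-⟪‖v‖⁻¹ • v, genGrad f c lam x⟫_ℝ) with h | h
  · exact ⟨_, _, 1, hnorm, hev', Or.inl rfl, by simpa using h, rfl⟩
  · exact ⟨_, _, -1, hnorm, hev', Or.inr rfl, by linarith, rfl⟩

theorem add_pow_three_le {a b : ℝ} (ha : 0 ≤ a) (hb : 0 ≤ b) :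
    (a + b) ^ 3 ≤ 4 * (a ^ 3 + b ^ 3) := by
  nlinarith [mul_nonneg (add_nonneg ha hb) (sq_nonneg (a - b))]

/-- Decrease of `f` along `t ↦ Π(x - t 𝒢(x) + τ d)` for a tangent direction `d` of nonincrease with
`ℋ(x) d = -‖d‖ d`. The case `d = 0` covers the gradient steps. -/
theorem exists_decrease_bound (hA : KeyAssumption f c) (hlam : IsMultiplier f c lam)
    (hM : UniformBound f c lam M) (hPi : IsProj (feasible c) Pi) :
    ∃ K, 0 ≤ K ∧ ∀ x ∈ feasible c, ∀ d ∈ tangentSpace c x, ⟪genGrad f c lam x, d⟫_ℝ ≤ 0 →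
      genHess f c lam x d = (-‖d‖) • d → ∀ t τ : ℝ, 0 ≤ t → 0 ≤ τ →
      f (Pi (x - t • genGrad f c lam x + τ • d)) - f x ≤
        -t * ‖genGrad f c lam x‖ ^ 2 * (1 - (M / 2 * t + 4 * K * M * t ^ 2))
          - 1 / 2 * τ ^ 2 * ‖d‖ ^ 3 * (1 - 8 * K * τ) := by
  obtain ⟨K, hK, hdesc⟩ := exists_descent_bound hA hlam hM hPi
  refine ⟨K, hK, fun x hx d hd hGd hHd t τ ht hτ => ?_⟩
  have hGt := genGrad_mem_tangentSpace hA hlam hx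
  have hGn := hM.genGrad_le x hx
  have hHG : ⟪genHess f c lam x (genGrad f c lam x), genGrad f c lam x⟫_ℝ ≤
      M * ‖genGrad f c lam x‖ ^ 2 := by
    rw [inner_genHess_of_mem hGt hGt, sq, ← mul_assoc]
    exact (real_inner_le_norm _ _).trans (mul_le_mul_of_nonneg_right
      ((hessL f c x (lam x)).le_of_opNorm_le (hM.hessL_le x hx) _) (norm_nonneg _))
  set G := genGrad f c lam x
  set H := genHess f c lam x
  have h := hdesc x hx (-(t • G) + τ • d)
    (Submodule.add_mem _ (Submodule.neg_mem _ (Submodule.smul_mem _ _ hGt))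
      (Submodule.smul_mem _ _ hd))
  have e0 : x - t • G + τ • d = x + (-(t • G) + τ • d) := by abel
  rw [e0]
  have hsym : ⟪H G, d⟫_ℝ = ⟪H d, G⟫_ℝ := by
    rw [real_inner_comm]
    exact (isSymmetric_genHess hA x d G).symm
  have hdG : ⟪H d, G⟫_ℝ = -‖d‖ * ⟪G, d⟫_ℝ := by
    rw [hHd, inner_smul_left, real_inner_comm]
    rfl
  have hdd : ⟪H d, d⟫_ℝ = -‖d‖ ^ 3 := by
    rw [hHd, inner_smul_left, real_inner_self_eq_norm_sq]
    simp
    ring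
  have e1 : ⟪G, -(t • G) + τ • d⟫_ℝ = -t * ‖G‖ ^ 2 + τ * ⟪G, d⟫_ℝ := by
    rw [inner_add_right, inner_neg_right, inner_smul_right, inner_smul_right,
      real_inner_self_eq_norm_sq]
    ring
  have e2 : ⟪H (-(t • G) + τ • d), -(t • G) + τ • d⟫_ℝ =
      t ^ 2 * ⟪H G, G⟫_ℝ + 2 * t * τ * (‖d‖ * ⟪G, d⟫_ℝ) - τ ^ 2 * ‖d‖ ^ 3 := by
    simp only [map_add, map_neg, map_smul, inner_add_left, inner_add_right, inner_neg_left,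
      inner_neg_right, inner_smul_left, inner_smul_right, hsym, hdG, hdd, RCLike.conj_to_real]
    ring
  have e3 : ‖-(t • G) + τ • d‖ ^ 3 ≤ 4 * (t ^ 3 * (M * ‖G‖ ^ 2) + τ ^ 3 * ‖d‖ ^ 3) := by
    have h1 : ‖-(t • G) + τ • d‖ ≤ t * ‖G‖ + τ * ‖d‖ := by
      refine (norm_add_le _ _).trans_eq ?_
      rw [norm_neg, norm_smul, norm_smul, Real.norm_of_nonneg ht, Real.norm_of_nonneg hτ]
    have h2 := (pow_le_pow_left₀ (norm_nonneg _) h1 3).trans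
      (add_pow_three_le (by positivity) (by positivity))
    have h3 : ‖G‖ ^ 3 ≤ M * ‖G‖ ^ 2 := by
      rw [pow_succ']
      exact mul_le_mul_of_nonneg_right hGn (sq_nonneg _)
    have h4 : t ^ 3 * ‖G‖ ^ 3 ≤ t ^ 3 * (M * ‖G‖ ^ 2) := by gcongr
    rw [mul_pow, mul_pow] at h2
    linarith
  have i1 : τ * ⟪G, d⟫_ℝ ≤ 0 := mul_nonpos_of_nonneg_of_nonpos hτ hGd
  have i2 : t * τ * (‖d‖ * ⟪G, d⟫_ℝ) ≤ 0 := mul_nonpos_of_nonneg_of_nonpos (by positivity)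
    (mul_nonpos_of_nonneg_of_nonpos (norm_nonneg _) hGd)
  have i3 : t ^ 2 * ⟪H G, G⟫_ℝ ≤ t ^ 2 * (M * ‖G‖ ^ 2) := by gcongr
  have i4 := mul_le_mul_of_nonneg_left e3 hK
  rw [e1, e2] at h
  refine h.trans ?_
  linarith

/-- Some positive step size, uniform over the feasible set, below which all tests succeed. -/
theorem exists_uniform_step (p : Params) (hA : KeyAssumption f c) (hlam : IsMultiplier f c lam)
    (hPi : IsProj (feasible c) Pi) :
    ∃ b, 0 < b ∧ ∀ x ∈ feasible c, ∀ t, 0 < t → t ≤ b →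
      gradTest p f c lam Pi x t ∧
        ∀ d, IsDirection f c lam x d → curvTest p f c lam Pi x d t := by
  obtain ⟨M, hM⟩ := exists_uniformBound hA hlam
  obtain ⟨K, hK, hdec⟩ := exists_decrease_bound hA hlam hM hPi
  have hσ : (0 : ℝ) < 1 - p.σ := sub_pos.mpr p.σ_lt
  have h1 : ∀ᶠ t : ℝ in 𝓝[>] 0, M / 2 * t + 4 * K * M * t ^ 2 < 1 - p.σ := by
    have hc : Continuous fun t : ℝ => M / 2 * t + 4 * K * M * t ^ 2 := by fun_prop
    exact nhdsWithin_le_nhds (hc.tendsto 0 |>.eventually_lt_const (by simpa using hσ))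
  have h2 : ∀ᶠ t : ℝ in 𝓝[>] 0, 8 * K * t ^ p.α < 1 - p.σ := by
    have hc : ContinuousAt (fun t : ℝ => 8 * K * t ^ p.α) 0 :=
      continuousAt_const.mul (Real.continuousAt_rpow_const 0 p.α (Or.inr p.α_pos.le))
    exact nhdsWithin_le_nhds (hc.tendsto.eventually_lt_const
      (by simpa [Real.zero_rpow p.α_pos.ne'] using hσ))
  obtain ⟨b, hb, hsub⟩ := mem_nhdsGT_iff_exists_Ioc_subset.mp (h1.and h2)
  refine ⟨b, hb, fun x hx t ht htb => ?_⟩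
  obtain ⟨ht1, ht2⟩ := hsub ⟨ht, htb⟩
  have hG : -t * ‖genGrad f c lam x‖ ^ 2 * (1 - (M / 2 * t + 4 * K * M * t ^ 2)) ≤
      -p.σ * t * ‖genGrad f c lam x‖ ^ 2 := by
    have : t * ‖genGrad f c lam x‖ ^ 2 * p.σ ≤
        t * ‖genGrad f c lam x‖ ^ 2 * (1 - (M / 2 * t + 4 * K * M * t ^ 2)) :=
      mul_le_mul_of_nonneg_left (by linarith) (by positivity)
    linarith
  constructor
  · have h := hdec x hx 0 (Submodule.zero_mem _) (by simp) (by simp) t 0 ht.le le_rfl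
    simp only [smul_zero, add_zero, norm_zero] at h
    refine h.trans ?_
    linarith
  · intro d hd
    obtain ⟨hdT, hdG, hdn, hdH⟩ := hd.properties
    have hτ : 0 ≤ t ^ p.α := Real.rpow_nonneg ht.le _
    have h := hdec x hx d hdT hdG (by rw [hdn]; exact hdH) t (t ^ p.α) ht.le hτ
    have hpow : t ^ (2 * p.α) = (t ^ p.α) ^ 2 := by
      rw [mul_comm, Real.rpow_mul ht.le, Real.rpow_two]
    have hD : 1 / 2 * (t ^ p.α) ^ 2 * ‖d‖ ^ 3 * p.σ ≤
        1 / 2 * (t ^ p.α) ^ 2 * ‖d‖ ^ 3 * (1 - 8 * K * t ^ p.α) :=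
      mul_le_mul_of_nonneg_left (by linarith) (by positivity)
    rw [curvTest, hpow, ← hdn]
    refine h.trans ?_
    linarith

end LineSearch

/-! ### Decrease along a run -/

section Run

variable {p : Params} {f : E n → ℝ} {c : Fin m → E n → ℝ} {lam : E n → Fin m → ℝ}
  {Pi : E n → E n}

theorem Iteration.mem_feasible (hPi : IsProj (feasible c) Pi) {x x' : E n}
    (h : Iteration p f c lam Pi x x') : x' ∈ feasible c := by
  rcases h with ⟨-, t, -, rfl⟩ | ⟨-, d, t, -, -, rfl⟩
  · exact (hPi _).1
  · exact (hPi _).1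

theorem IsRun.mem_feasible (hPi : IsProj (feasible c) Pi) {x : ℕ → E n}
    (hx : IsRun p f c lam Pi x) (k : ℕ) : x k ∈ feasible c := by
  cases k with
  | zero => exact hx.1
  | succ k => exact (hx.2 k).mem_feasible hPi

/-- Every iteration decreases `f` by an amount controlled from below by `‖𝒢‖²` and, when it is a
curvilinear step, by `|λ|³`, with a constant that is uniform over the feasible set. -/
theorem exists_iteration_decrease (p : Params) (hA : KeyAssumption f c)
    (hlam : IsMultiplier f c lam) (hPi : IsProj (feasible c) Pi) :
    ∃ a, 0 < a ∧ ∀ x ∈ feasible c, ∀ x', Iteration p f c lam Pi x x' →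
      a * ‖genGrad f c lam x‖ ^ 2 ≤ f x - f x' ∧
        (‖genGrad f c lam x‖ < p.ε → a * |negEig f c lam x| ^ 3 ≤ f x - f x') := by
  obtain ⟨b, hb, hstep⟩ := exists_uniform_step p hA hlam hPi
  have hτ : 0 < min p.t₀ (p.ρ * b) := lt_min p.t₀_pos (mul_pos p.ρ_pos hb)
  set τ := min p.t₀ (p.ρ * b) with hτdef
  have hσ := p.σ_pos
  have hτα : 0 < τ ^ (2 * p.α) := Real.rpow_pos_of_pos hτ _
  refine ⟨min (p.σ * τ) (p.σ * (1 / 2 * τ ^ (2 * p.α))), by positivity, fun x hx x' h => ?_⟩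
  set g := ‖genGrad f c lam x‖
  set l := |negEig f c lam x|
  have hl : 0 ≤ l := abs_nonneg _
  have hgt : ∀ t, τ ≤ t → min (p.σ * τ) (p.σ * (1 / 2 * τ ^ (2 * p.α))) * g ^ 2 ≤
      p.σ * t * g ^ 2 := fun t ht => by
    refine mul_le_mul_of_nonneg_right ((min_le_left _ _).trans ?_) (sq_nonneg _)
    gcongr
  rcases h with ⟨hε, t, ht, rfl⟩ | ⟨hε, d, t, hd, ht, rfl⟩
  · have hτt := ht.min_le fun t h1 h2 => (hstep x hx t h1 h2).1
    obtain ⟨-, -, htest, -⟩ := ht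
    rw [gradTest] at htest
    refine ⟨?_, fun h => absurd h (not_lt.mpr hε)⟩
    linarith [hgt t hτt]
  · have hτt := ht.min_le fun t h1 h2 => (hstep x hx t h1 h2).2 d hd
    have ht0 : 0 < t := hτ.trans_le hτt
    obtain ⟨-, -, htest, -⟩ := ht
    rw [curvTest] at htest
    have h1 : 0 ≤ p.σ * (t * g ^ 2) := by positivity
    have h2 : 0 ≤ p.σ * (1 / 2 * t ^ (2 * p.α) * l ^ 3) := by positivity
    refine ⟨by linarith [hgt t hτt], fun _ => ?_⟩
    have h3 : min (p.σ * τ) (p.σ * (1 / 2 * τ ^ (2 * p.α))) * l ^ 3 ≤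
        p.σ * (1 / 2 * t ^ (2 * p.α)) * l ^ 3 := by
      refine mul_le_mul_of_nonneg_right ((min_le_right _ _).trans ?_) (by positivity)
      have : τ ^ (2 * p.α) ≤ t ^ (2 * p.α) :=
        Real.rpow_le_rpow hτ.le hτt (mul_nonneg two_pos.le p.α_pos.le)
      gcongr
    linarith

theorem tendsto_zero_of_mul_pow_le {u δ : ℕ → ℝ} {a : ℝ} (ha : 0 < a) (q : ℕ)
    (hδ : Tendsto δ atTop (𝓝 0)) (h : ∀ᶠ k in atTop, a * |u k| ^ q ≤ δ k) :
    Tendsto u atTop (𝓝 0) := by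
  rw [tendsto_zero_iff_abs_tendsto_zero]
  refine tendsto_order.mpr ⟨fun b hb => Eventually.of_forall fun k => hb.trans_le (abs_nonneg _),
    fun b hb => ?_⟩
  filter_upwards [h, hδ.eventually_lt_const (mul_pos ha (pow_pos hb q))] with k h1 h2
  exact lt_of_pow_lt_pow_left₀ q hb.le (lt_of_mul_lt_mul_left (h1.trans_lt h2) ha.le)

theorem IsRun.tendsto_zero (hA : KeyAssumption f c) (hf : BddBelow (f '' feasible c))
    (hlam : IsMultiplier f c lam) (hPi : IsProj (feasible c) Pi) {x : ℕ → E n}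
    (hx : IsRun p f c lam Pi x) :
    Tendsto (fun k => genGrad f c lam (x k)) atTop (𝓝 0) ∧
      Tendsto (fun k => negEig f c lam (x k)) atTop (𝓝 0) := by
  obtain ⟨a, ha, hdec⟩ := exists_iteration_decrease p hA hlam hPi
  have hstep := fun k => hdec (x k) (hx.mem_feasible hPi k) (x (k + 1)) (hx.2 k)
  have hanti : Antitone fun k => f (x k) := antitone_nat_of_succ_le fun k => by
    have : 0 ≤ a * ‖genGrad f c lam (x k)‖ ^ 2 := by positivity
    linarith [(hstep k).1]
  have hbdd : BddBelow (range fun k => f (x k)) :=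
    hf.mono (range_subset_iff.mpr fun k => mem_image_of_mem f (hx.mem_feasible hPi k))
  have hlim := tendsto_atTop_ciInf hanti hbdd
  have hδ : Tendsto (fun k => f (x k) - f (x (k + 1))) atTop (𝓝 0) := by
    simpa using hlim.sub (hlim.comp (tendsto_add_atTop_nat 1))
  have hG : Tendsto (fun k => ‖genGrad f c lam (x k)‖) atTop (𝓝 0) :=
    tendsto_zero_of_mul_pow_le ha 2 hδ (Eventually.of_forall fun k => by
      simpa using (hstep k).1)
  refine ⟨tendsto_zero_iff_norm_tendsto_zero.mpr hG, ?_⟩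
  exact tendsto_zero_of_mul_pow_le ha 3 hδ
    ((hG.eventually_lt_const p.ε_pos).mono fun k hk => (hstep k).2 hk)

end Run

/-! ### Continuity along feasible sequences and cluster points -/

section Cluster

variable {f : E n → ℝ} {c : Fin m → E n → ℝ} {lam : E n → Fin m → ℝ} {M : ℝ}
  {ι : Type*} {l : Filter ι} {y : ι → E n} {z : E n}

/-- Stability of least-squares coefficients: `μ` and `μ'` are the coefficients of the best
approximations of `b` and `b'` by constraint gradients at `x` and `z`. -/
theorem norm_sum_coeff_sub_le (hM : UniformBound f c lam M) {x z b b' : E n}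
    (hx : x ∈ feasible c) {μ μ' : Fin m → ℝ}
    (hμ : b - ∑ i, μ i • gradient (c i) x ∈ tangentSpace c x)
    (hμ' : b' - ∑ i, μ' i • gradient (c i) z ∈ tangentSpace c z) :
    ‖∑ i, (μ i - μ' i) • gradient (c i) x‖ ≤
      ‖b - b' - ∑ i, μ' i • (gradient (c i) x - gradient (c i) z)‖ +
        m * (M * (‖b' - ∑ i, μ' i • gradient (c i) z‖ *
          ∑ i, ‖gradient (c i) x - gradient (c i) z‖)) := by
  have hM0 := hM.nonneg
  have hcoeff := hM.coeff_le x hx (fun i => μ i - μ' i)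
  have hdec : ∑ i, (μ i - μ' i) • gradient (c i) x =
      (b - b' - ∑ i, μ' i • (gradient (c i) x - gradient (c i) z)) +
        (b' - ∑ i, μ' i • gradient (c i) z) - (b - ∑ i, μ i • gradient (c i) x) := by
    simp only [sub_smul, smul_sub, Finset.sum_sub_distrib]
    abel
  have hwr : ⟪∑ i, (μ i - μ' i) • gradient (c i) x, b - ∑ i, μ i • gradient (c i) x⟫_ℝ = 0 := by
    rw [sum_inner]
    exact Finset.sum_eq_zero fun i _ => by
      rw [inner_smul_left, mem_tangentSpace_iff.mp hμ i, mul_zero]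
  set w := ∑ i, (μ i - μ' i) • gradient (c i) x with hw
  set e := b - b' - ∑ i, μ' i • (gradient (c i) x - gradient (c i) z)
  set r := b - ∑ i, μ i • gradient (c i) x
  set r' := b' - ∑ i, μ' i • gradient (c i) z
  set η := ∑ i, ‖gradient (c i) x - gradient (c i) z‖
  have hη : 0 ≤ η := Finset.sum_nonneg fun i _ => norm_nonneg _
  have hwr' : ⟪w, r'⟫_ℝ ≤ m * (M * ‖w‖ * (‖r'‖ * η)) := by
    have h1 : ⟪w, r'⟫_ℝ = ∑ i, (μ i - μ' i) • ⟪gradient (c i) x - gradient (c i) z, r'⟫_ℝ := by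
      rw [hw, sum_inner]
      refine Finset.sum_congr rfl fun i _ => ?_
      rw [inner_smul_left, inner_sub_left, mem_tangentSpace_iff.mp hμ' i, sub_zero]
      rfl
    have h2 : ∀ i, ‖⟪gradient (c i) x - gradient (c i) z, r'⟫_ℝ‖ ≤ ‖r'‖ * η := by
      intro i
      refine (norm_inner_le_norm _ _).trans ?_
      rw [mul_comm]
      refine mul_le_mul_of_nonneg_left ?_ (norm_nonneg _)
      exact Finset.single_le_sum (f := fun i => ‖gradient (c i) x - gradient (c i) z‖)
        (fun i _ => norm_nonneg _) (Finset.mem_univ i)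
    have h3 := norm_sum_smul_le (mul_nonneg hM0 (norm_nonneg w)) hcoeff h2
    rw [← h1] at h3
    exact (le_abs_self _).trans h3
  have hB : 0 ≤ ‖e‖ + m * (M * (‖r'‖ * η)) := by positivity
  refine le_of_mul_self_le_mul hB ?_
  have h1 : ‖w‖ * ‖w‖ = ⟪w, e⟫_ℝ + ⟪w, r'⟫_ℝ - ⟪w, r⟫_ℝ := by
    rw [← real_inner_self_eq_norm_mul_norm, ← inner_add_right, ← inner_sub_right, ← hdec]
  have h2 := real_inner_le_norm w e
  rw [h1, hwr]
  linarith

/-- Least-squares coefficients with respect to the constraint gradients depend continuously on the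
base point and on the approximated vector. -/
theorem tendsto_coeff (hA : KeyAssumption f c) (hM : UniformBound f c lam M)
    (hy : ∀ k, y k ∈ feasible c) (hyz : Tendsto y l (𝓝 z)) {b : ι → E n} {b' : E n}
    (hb : Tendsto b l (𝓝 b')) {μ : ι → Fin m → ℝ} {μ' : Fin m → ℝ}
    (hμ : ∀ k, b k - ∑ i, μ k i • gradient (c i) (y k) ∈ tangentSpace c (y k))
    (hμ' : b' - ∑ i, μ' i • gradient (c i) z ∈ tangentSpace c z) (i : Fin m) :
    Tendsto (fun k => μ k i) l (𝓝 (μ' i)) := by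
  have hgrad : ∀ i, Tendsto (fun k => gradient (c i) (y k) - gradient (c i) z) l (𝓝 0) :=
    fun i => tendsto_sub_nhds_zero_iff.mpr
      (((contDiff_gradient (hA.smooth_c i)).continuous.tendsto z).comp hyz)
  have he : Tendsto (fun k => b k - b' -
      ∑ i, μ' i • (gradient (c i) (y k) - gradient (c i) z)) l (𝓝 0) := by
    have h := (tendsto_sub_nhds_zero_iff.mpr hb).sub
      (tendsto_finsetSum Finset.univ fun i _ => (hgrad i).const_smul (μ' i))
    simpa only [smul_zero, Finset.sum_const_zero, sub_zero] using h
  have hη : Tendsto (fun k => ∑ i, ‖gradient (c i) (y k) - gradient (c i) z‖) l (𝓝 0) := by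
    have h := tendsto_finsetSum Finset.univ fun i (_ : i ∈ Finset.univ) => (hgrad i).norm
    simpa only [norm_zero, Finset.sum_const_zero] using h
  have hbound := (he.norm.add (((hη.const_mul ‖b' - ∑ i, μ' i • gradient (c i) z‖).const_mul
    M).const_mul (m : ℝ))).const_mul M
  simp only [norm_zero, mul_zero, add_zero] at hbound
  refine tendsto_sub_nhds_zero_iff.mp (squeeze_zero_norm (fun k => ?_) hbound)
  exact (hM.coeff_le (y k) (hy k) (fun i => μ k i - μ' i) i).trans
    (mul_le_mul_of_nonneg_left (norm_sum_coeff_sub_le hM (hy k) (hμ k) hμ') hM.nonneg)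

theorem tendsto_sum_smul_gradient (hA : KeyAssumption f c) (hyz : Tendsto y l (𝓝 z))
    {μ : ι → Fin m → ℝ} {μ' : Fin m → ℝ} (hμ : ∀ i, Tendsto (fun k => μ k i) l (𝓝 (μ' i))) :
    Tendsto (fun k => ∑ i, μ k i • gradient (c i) (y k)) l
      (𝓝 (∑ i, μ' i • gradient (c i) z)) :=
  tendsto_finsetSum _ fun i _ =>
    (hμ i).smul (((contDiff_gradient (hA.smooth_c i)).continuous.tendsto z).comp hyz)

theorem exists_tanProj_eq (c : Fin m → E n → ℝ) (x u : E n) :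
    ∃ μ : Fin m → ℝ, tanProj c x u = u - ∑ i, μ i • gradient (c i) x := by
  have h : u - tanProj c x u ∈ normalSpace c x := by
    rw [← Submodule.orthogonal_orthogonal (normalSpace c x)]
    exact Submodule.sub_starProjection_mem_orthogonal u
  obtain ⟨μ, hμ⟩ := (Submodule.mem_span_range_iff_exists_fun ℝ).mp h
  exact ⟨μ, by rw [hμ]; abel⟩

theorem tendsto_tanProj (hA : KeyAssumption f c) (hM : UniformBound f c lam M)
    (hy : ∀ k, y k ∈ feasible c) (hyz : Tendsto y l (𝓝 z)) (u : E n) :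
    Tendsto (fun k => tanProj c (y k) u) l (𝓝 (tanProj c z u)) := by
  choose μ hμ using fun x => exists_tanProj_eq c x u
  have hmem : ∀ x, u - ∑ i, μ x i • gradient (c i) x ∈ tangentSpace c x := fun x => by
    rw [← hμ]
    exact tanProj_mem x u
  have h := tendsto_coeff hA hM hy hyz tendsto_const_nhds (fun k => hmem (y k)) (hmem z)
  simp only [hμ]
  exact tendsto_const_nhds.sub (tendsto_sum_smul_gradient hA hyz h)

theorem tendsto_multiplier (hA : KeyAssumption f c) (hlam : IsMultiplier f c lam)
    (hM : UniformBound f c lam M) (hy : ∀ k, y k ∈ feasible c) (hz : z ∈ feasible c)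
    (hyz : Tendsto y l (𝓝 z)) (i : Fin m) :
    Tendsto (fun k => lam (y k) i) l (𝓝 (lam z i)) := by
  refine tendsto_coeff hA hM hy hyz
    (((contDiff_gradient hA.smooth_f).continuous.tendsto z).comp hyz) (fun k => ?_) ?_ i
  · exact genGrad_eq (lam := lam) hA (y k) ▸ genGrad_mem_tangentSpace hA hlam (hy k)
  · exact genGrad_eq (lam := lam) hA z ▸ genGrad_mem_tangentSpace hA hlam hz

theorem tendsto_genGrad (hA : KeyAssumption f c) (hlam : IsMultiplier f c lam)
    (hM : UniformBound f c lam M) (hy : ∀ k, y k ∈ feasible c) (hz : z ∈ feasible c)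
    (hyz : Tendsto y l (𝓝 z)) :
    Tendsto (fun k => genGrad f c lam (y k)) l (𝓝 (genGrad f c lam z)) := by
  simp only [genGrad_eq hA]
  exact (((contDiff_gradient hA.smooth_f).continuous.tendsto z).comp hyz).sub
    (tendsto_sum_smul_gradient hA hyz (tendsto_multiplier hA hlam hM hy hz hyz))

theorem continuous_hess {g : E n → ℝ} (hg : ContDiff ℝ 2 g) : Continuous (hess g) :=
  (contDiff_gradient hg).continuous_fderiv one_ne_zero

theorem tendsto_inner_genHess (hA : KeyAssumption f c) (hlam : IsMultiplier f c lam)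
    (hM : UniformBound f c lam M) (hy : ∀ k, y k ∈ feasible c) (hz : z ∈ feasible c)
    (hyz : Tendsto y l (𝓝 z)) (u : E n) :
    Tendsto (fun k => ⟪genHess f c lam (y k) u, u⟫_ℝ) l (𝓝 ⟪genHess f c lam z u, u⟫_ℝ) := by
  have hP := tendsto_tanProj hA hM hy hyz u
  have hH : Tendsto (fun k => hessL f c (y k) (lam (y k))) l (𝓝 (hessL f c z (lam z))) := by
    simp only [hessL_eq hA]
    exact (((continuous_hess hA.smooth_f).tendsto z).comp hyz).sub
      (tendsto_finsetSum _ fun i _ => (tendsto_multiplier hA hlam hM hy hz hyz i).smul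
        (((continuous_hess (hA.smooth_c i)).tendsto z).comp hyz))
  simp only [inner_genHess]
  exact (((isBoundedBilinearMap_apply (𝕜 := ℝ)).continuous.tendsto _).comp
    (hH.prodMk_nhds hP)).inner hP

/-- A limit of feasible points along which `𝒢` and `min {λ_min(ℋ), 0}` tend to zero is second-order
critical. -/
theorem isSecondOrderCritical_of_tendsto [l.NeBot] (hA : KeyAssumption f c)
    (hlam : IsMultiplier f c lam) (hy : ∀ k, y k ∈ feasible c) (hyz : Tendsto y l (𝓝 z))
    (hG : Tendsto (fun k => genGrad f c lam (y k)) l (𝓝 0))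
    (hneg : Tendsto (fun k => negEig f c lam (y k)) l (𝓝 0)) :
    IsSecondOrderCritical f c lam z := by
  obtain ⟨M, hM⟩ := exists_uniformBound hA hlam
  have hz : z ∈ feasible c := fun i => tendsto_nhds_unique
    (((hA.smooth_c i).continuous.tendsto z).comp hyz)
    (tendsto_const_nhds.congr fun k => (hy k i).symm)
  refine ⟨hz, tendsto_nhds_unique (tendsto_genGrad hA hlam hM hy hz hyz) hG, ?_⟩
  refine ⟨isSymmetric_genHess hA z, fun u => ?_⟩
  have h1 : Tendsto (fun k => negEig f c lam (y k) * ‖u‖ ^ 2) l (𝓝 0) := by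
    simpa using hneg.mul_const (‖u‖ ^ 2)
  refine le_of_tendsto_of_tendsto' h1 (tendsto_inner_genHess hA hlam hM hy hz hyz u) fun k => ?_
  exact (mul_le_mul_of_nonneg_right (min_le_left _ _) (sq_nonneg _)).trans
    (minEig_mul_norm_sq_le_inner (isSymmetric_genHess hA (y k)) u)

end Cluster

end NegCurv

end

theorem theorem2 {n m : ℕ} (hn : 0 < n)
    (f : NegCurv.E n → ℝ) (c : Fin m → NegCurv.E n → ℝ)
    (hA : NegCurv.KeyAssumption f c)
    (hf : BddBelow (f '' NegCurv.feasible c))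
    (lam : NegCurv.E n → Fin m → ℝ) (hlam : NegCurv.IsMultiplier f c lam)
    (Pi : NegCurv.E n → NegCurv.E n) (hPi : NegCurv.IsProj (NegCurv.feasible c) Pi)
    (p : NegCurv.Params) :
    (∀ x ∈ NegCurv.feasible c, NegCurv.IterationTerminates p f c lam Pi x) ∧
    ∀ x : ℕ → NegCurv.E n, NegCurv.IsRun p f c lam Pi x →
      Tendsto (fun k => NegCurv.genGrad f c lam (x k)) atTop (𝓝 0) ∧
      Tendsto (fun k => NegCurv.negEig f c lam (x k)) atTop (𝓝 0) ∧
      ∀ xstar : NegCurv.E n, MapClusterPt xstar atTop x →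
        NegCurv.IsSecondOrderCritical f c lam xstar := by
  constructor
  · obtain ⟨b, hb, hstep⟩ := NegCurv.exists_uniform_step p hA hlam hPi
    intro x hx
    exact ⟨fun _ => NegCurv.Backtrack.exists_of_forall_le hb fun t h1 h2 => (hstep x hx t h1 h2).1,
      fun _ => ⟨NegCurv.exists_isDirection hn hA x, fun d hd =>
        NegCurv.Backtrack.exists_of_forall_le hb fun t h1 h2 => (hstep x hx t h1 h2).2 d hd⟩⟩
  · intro x hx
    obtain ⟨hG, hneg⟩ := hx.tendsto_zero hA hf hlam hPi
    refine ⟨hG, hneg, fun xstar hstar => ?_⟩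
    obtain ⟨U, hU, hlim⟩ := mapClusterPt_iff_ultrafilter.mp hstar
    exact NegCurv.isSecondOrderCritical_of_tendsto hA hlam (fun k => hx.mem_feasible hPi k) hlim
      (hG.mono_left hU) (hneg.mono_left hU)
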